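/- **Lower bound on the error of private histograms.** Let $[d]=\{1,\dots,d\}$ be the set of items and $\mathcal Z$ an arbitrary measurable space. A randomized map $Q:[d]\to\mathcal Z$ is $(\varepsilon,\delta)$-LDP if $\Pr[Q(v)\in S]\le e^{\varepsilon}\Pr[Q(v')\in S]+\delta$ for all $v,v'\in[d]$ and all measurable $S\subseteq\mathcal Z$. Given items $v_1,\dots,v_n\in[d]$, let $f\in[0,1]^d$, $f(u)=\frac1n\#\{i: v_i=u\}$, be their frequency vector. For every $C>0$ there are constants $c,\kappa>0$, depending only on $C$, such that the following holds for all integers $n\ge 2$, $d\ge 1$, all $0<\varepsilon\le C$ and all $0\le\delta\le\frac{\kappa}{n\log n}$ (so, for all sufficiently large $n$, for any $\varepsilon=O(1)$ and any $0\le\delta\le o\!\left(\frac1{n\log n}\right)$). For all $(\varepsilon,\delta)$-LDP randomized maps $Q_1,\dots,Q_n:[d]\to\mathcal Z$ and every (possibly randomized) estimator $\mathcal B:\mathcal Z^n\to[0,1]^d$ there is a probability distribution $P$ on $[d]$ such that, if $v_1,\dots,v_n$ are drawn i.i.d. from $P$, the reports $z_i=Q_i(v_i)$ are generated with independent randomness,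 and $\hat f=\mathcal B(z_1,\dots,z_n)$, then $$\mathbb E\Big[\max_{u\in[d]}|\hat f(u)-f(u)|\Big]\;\ge\; c\,\min\!\left(\frac1\varepsilon\sqrt{\frac{\log d}{n}},\,1\right).$$ -/

import Mathlib

open MeasureTheory ProbabilityTheory

noncomputable section

/-- `(ε, δ)`-local differential privacy of a randomized map `Q` from the items `{0, …, d - 1}` to
reports in `Z`: `Pr[Q(v) ∈ S] ≤ e^ε Pr[Q(v') ∈ S] + δ` for all items `v, v'` and measurable `S`. -/
def IsLDP {d : ℕ} {Z : Type*} [MeasurableSpace Z] (ε δ : ℝ) (Q : Kernel (Fin d) Z) : Prop :=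
  ∀ v v' : Fin d, ∀ S : Set Z, MeasurableSet S →
    (Q v).real S ≤ Real.exp ε * (Q v').real S + δ

/-- The empirical frequency vector `f(u) = #{i : v i = u} / n` of the items `v 0, …, v (n - 1)`. -/
def freq {n d : ℕ} (v : Fin n → Fin d) : Fin d → ℝ :=
  fun u => ((Finset.univ.filter fun i => v i = u).card : ℝ) / n

/-- The error `max_u |g(u) - f(u)|` of an estimate `g ∈ [0,1]^d` of the frequency vector `f`
(the norm on `Fin d → ℝ` is the sup norm). -/
def linfError {d : ℕ} (f : Fin d → ℝ) (g : Fin d → Set.Icc (0 : ℝ) 1) : ℝ :=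
  ‖(fun u => (g u : ℝ)) - f‖

/-- The expected error of the (possibly randomized) estimator `B` when the items `v i` are i.i.d.
with law `P`, the reports are generated independently, the `i`-th one by `Q i` applied to `v i`, and
`B` is applied to the reports. -/
def expectedError {n d : ℕ} {Z : Type*} [MeasurableSpace Z] (P : Measure (Fin d))
    (Q : Fin n → Kernel (Fin d) Z) (B : Kernel (Fin n → Z) (Fin d → Set.Icc (0 : ℝ) 1)) : ℝ :=
  ∫ v, ∫ z, ∫ g, linfError (freq v) g ∂(B z)
    ∂(Measure.pi fun i => Q i (v i)) ∂(Measure.pi fun _ : Fin n => P)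

end

/-! The hard instances are the spiked laws `P_u = (1 - η) δ_0 + η δ_u`. An estimate accurate to
within `η / 4` reveals `u` by thresholding, unless the empirical frequency of `u` falls below `η /
2`, which a Chernoff bound makes rare. So a small error forces the reports to identify `u` among `d`
candidates.

Privacy prevents this. Relative to the reports of the all-`0` input, the likelihood ratio of one
report under `P_u`, truncated at a loss of mass `η δ`, has second moment at most `1 + η² (e^ε +
e^{-ε} - 2 + δ)` (`hasSquareDensity_mixture`). Second moments multiply over the `n` users while the
lost masses add (`exists_lintegral_pi_le`). By Cauchy–Schwarz, the probability of decoding `u` under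
`P_u` exceeds `n η δ` by at most `√(K^n q_u)`, where `K` is the second-moment bound and `q_u` is at
most the probability of decoding `u` under the reference. The decoding events are disjoint, so `∑
q_u ≤ 1` and some `u` has `q_u ≤ 1 / d`. As `e^ε + e^{-ε} - 2` is of order `ε²` for `ε ≤ C`, an `η`
of order `min (√(log d / n) / ε) 1` keeps `K^n / d` bounded away from 1, and the error is of order
`η`.

The Chernoff bound needs `n η` large, which can fail only for `n` below a threshold depending on
`C`. There a two-point comparison gives a bound exponentially small in `n`, hence a constant
depending only on `C`. -/

/-! ### Second moments of truncated likelihood ratios -/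

/-- Truncated likelihood ratio of two laws that are `(ε, δ)`-indistinguishable. -/
theorem exists_truncated_density {Z : Type*} [MeasurableSpace Z] (μ ν : Measure Z)
    [IsProbabilityMeasure μ] [IsProbabilityMeasure ν] {ε δ : ℝ}
    (hνμ : ∀ S, MeasurableSet S → ν.real S ≤ Real.exp ε * μ.real S + δ)
    (hμν : ∀ S, MeasurableSet S → μ.real S ≤ Real.exp ε * ν.real S + δ) :
    ∃ t : Z → ℝ, Measurable t ∧ (∀ z, 0 ≤ t z) ∧ (∀ z, t z ≤ Real.exp ε) ∧
      ∫ z, t z ∂μ ≤ 1 ∧ ∫ z, t z ^ 2 ∂μ ≤ Real.exp ε + Real.exp (-ε) - 1 + δ ∧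
      ∀ φ : Z → ENNReal, Measurable φ → (∀ z, φ z ≤ 1) →
        ∫⁻ z, φ z ∂ν ≤ ENNReal.ofReal δ + ∫⁻ z, φ z * ENNReal.ofReal (t z) ∂μ := by
  set a := Real.exp ε with ha
  have ha0 : 0 < a := Real.exp_pos ε
  set r : Z → ℝ := fun z => (ν.rnDeriv μ z).toReal with hr
  have hrm : Measurable r := (Measure.measurable_rnDeriv ν μ).ennreal_toReal
  have hr0 : ∀ z, 0 ≤ r z := fun z => ENNReal.toReal_nonneg
  have hrint : Integrable r μ := Measure.integrable_toReal_rnDeriv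
  obtain ⟨A, hA, hsA, hμA⟩ := Measure.mutuallySingular_singularPart ν μ
  have hdec := Measure.haveLebesgueDecomposition_add ν μ
  have hwd : μ.withDensity (ν.rnDeriv μ) = μ.withDensity (fun z => ENNReal.ofReal (r z)) := by
    apply withDensity_congr_ae
    filter_upwards [Measure.rnDeriv_lt_top ν μ] with z hz
    simp [hr, ENNReal.ofReal_toReal hz.ne]
  rw [hwd] at hdec
  set ρ := ν.singularPart μ with hρ
  have hfin : IsFiniteMeasure ρ := by rw [hρ]; infer_instance
  have hνS : ∀ S, MeasurableSet S → ν.real S = ρ.real S + ∫ z in S, r z ∂μ := by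
    intro S hS
    have : ν S = ρ S + ENNReal.ofReal (∫ z in S, r z ∂μ) := by
      conv_lhs => rw [hdec]
      rw [Measure.add_apply, withDensity_apply _ hS,
        ofReal_integral_eq_lintegral_ofReal hrint.integrableOn (ae_of_all _ hr0)]
    rw [measureReal_def, this, ENNReal.toReal_add (measure_ne_top _ _) ENNReal.ofReal_ne_top,
      ENNReal.toReal_ofReal (setIntegral_nonneg hS fun z _ => hr0 z), measureReal_def]
  have hAμ : ∀ᵐ z ∂μ, z ∈ A := by
    rw [ae_iff]; exact hμA
  set t : Z → ℝ := fun z => min (r z) a with ht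
  have htm : Measurable t := hrm.min measurable_const
  have ht0 : ∀ z, 0 ≤ t z := fun z => le_min (hr0 z) ha0.le
  have hta : ∀ z, t z ≤ a := fun z => min_le_right _ _
  have htr : ∀ z, t z ≤ r z := fun z => min_le_left _ _
  have htint : Integrable t μ := by
    refine Integrable.mono' hrint htm.aestronglyMeasurable (ae_of_all _ fun z => ?_)
    rw [Real.norm_of_nonneg (ht0 z)]; exact htr z
  have ht2int : Integrable (fun z => t z ^ 2) μ := by
    refine Integrable.mono' (integrable_const (a ^ 2)) (htm.pow_const 2).aestronglyMeasurable
      (ae_of_all _ fun z => ?_)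
    rw [Real.norm_of_nonneg (sq_nonneg _)]
    exact pow_le_pow_left₀ (ht0 z) (hta z) 2
  have hm : ∫ z, t z ∂μ ≤ 1 := by
    have h1 := hνS Set.univ MeasurableSet.univ
    simp only [probReal_univ, Measure.restrict_univ] at h1
    have h2 : ∫ z, t z ∂μ ≤ ∫ z, r z ∂μ := integral_mono htint hrint htr
    have h3 : 0 ≤ ρ.real Set.univ := measureReal_nonneg
    linarith
  -- the mass lost by truncation
  have hlost : ρ.real Set.univ + ∫ z, (r z - t z) ∂μ ≤ δ := by
    -- `S` carries the whole singular part and the region where truncation acts, so privacy on `S`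
    -- bounds exactly the lost mass.
    set S := Aᶜ ∪ {z | a < r z} with hS
    have hSm : MeasurableSet S := hA.compl.union (measurableSet_lt measurable_const hrm)
    have h1 := hνμ S hSm
    rw [hνS S hSm] at h1
    have h2 : ρ.real Set.univ ≤ ρ.real S := by
      have : ρ.real Set.univ ≤ ρ.real A + ρ.real S := by
        refine (measureReal_mono (?_ : Set.univ ⊆ A ∪ S)).trans (measureReal_union_le _ _)
        intro z _
        by_cases hz : z ∈ A
        · exact Or.inl hz
        · exact Or.inr (Or.inl hz)
      have h0 : ρ.real A = 0 := by rw [measureReal_def, hsA]; rfl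
      linarith
    have h3 : ∫ z, (r z - t z) ∂μ = ∫ z in S, (r z - a) ∂μ := by
      rw [← integral_indicator hSm]
      apply integral_congr_ae
      filter_upwards [hAμ] with z hz
      by_cases hza : a < r z
      · have hzS : z ∈ S := Or.inr hza
        rw [Set.indicator_of_mem hzS]
        simp [ht, min_eq_right hza.le]
      · rw [Set.indicator_of_notMem]
        · simp [ht, min_eq_left (not_lt.1 hza)]
        · rintro (h | h)
          · exact h hz
          · exact hza h
    have h4 : ∫ z in S, (r z - a) ∂μ = ∫ z in S, r z ∂μ - a * μ.real S := by
      rw [integral_sub hrint.integrableOn (integrable_const a)]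
      simp [mul_comm]
    linarith
  -- the defect below `1 / a`
  have hdef : ∫ z, max (1 - a * r z) 0 ∂μ ≤ δ := by
    -- The reversed privacy inequality on `T`, where `ν` has no singular mass, reads `μ(T) - a ∫_T r
    -- ≤ δ`.
    set T := A ∩ {z | a * r z < 1} with hT
    have hTm : MeasurableSet T :=
      hA.inter (measurableSet_lt (hrm.const_mul a) measurable_const)
    have h1 := hμν T hTm
    rw [hνS T hTm] at h1
    have h2 : ρ.real T = 0 := by
      rw [measureReal_def, measure_mono_null Set.inter_subset_left hsA]; rfl
    have h3 : ∫ z, max (1 - a * r z) 0 ∂μ = ∫ z in T, (1 - a * r z) ∂μ := by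
      rw [← integral_indicator hTm]
      apply integral_congr_ae
      filter_upwards [hAμ] with z hz
      by_cases hza : a * r z < 1
      · have hzT : z ∈ T := ⟨hz, hza⟩
        rw [Set.indicator_of_mem hzT, max_eq_left (by linarith)]
      · have hzT : z ∉ T := fun h => hza h.2
        rw [Set.indicator_of_notMem hzT, max_eq_right (by linarith)]
    have h4 : ∫ z in T, (1 - a * r z) ∂μ = μ.real T - a * ∫ z in T, r z ∂μ := by
      rw [integral_sub (integrable_const _) (hrint.const_mul a).integrableOn,
        integral_const_mul]
      simp
    rw [h3, h4]
    rw [h2, zero_add] at h1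
    linarith
  have hdefint : Integrable (fun z => max (1 - a * r z) 0) μ :=
    ((integrable_const 1).sub (hrint.const_mul a)).pos_part
  have hae : Real.exp (-ε) = 1 / a := by rw [ha, Real.exp_neg, one_div]
  have hsq : ∫ z, t z ^ 2 ∂μ ≤ a + Real.exp (-ε) - 1 + δ := by
    rw [hae]
    have hint : Integrable (fun z => (a + 1 / a) * t z - 1) μ :=
      (htint.const_mul _).sub (integrable_const 1)
    have h1 : ∫ z, t z ^ 2 ∂μ ≤ ∫ z, ((a + 1 / a) * t z - 1 + max (1 - a * r z) 0) ∂μ := by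
      refine integral_mono ht2int (hint.add hdefint) fun z => ?_
      have hmul : a * (1 / a) = 1 := by field_simp
      have hb : 0 < 1 / a := by positivity
      -- Pure privacy would confine the ratio to `[1/a, a]`, making this product nonpositive; the
      -- positive part pays for values below `1/a`. Expanding the product bounds `t²` by a function
      -- linear in `t`, up to that defect.
      have key : (t z - a) * (t z - 1 / a) ≤ max (1 - a * r z) 0 := by
        rcases le_total (1 / a) (t z) with h | h
        · exact (mul_nonpos_of_nonpos_of_nonneg (by linarith [hta z]) (by linarith)).trans
            (le_max_right _ _)
        · rcases le_total (r z) a with h' | h'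
          · have : t z = r z := min_eq_left h'
            rw [this] at h ⊢
            refine le_trans ?_ (le_max_left _ _)
            nlinarith [mul_nonneg (hr0 z) (sub_nonneg.2 h)]
          · have : t z = a := min_eq_right h'
            rw [this]; simp
      simp only
      nlinarith
    rw [integral_add hint hdefint,
      integral_sub (htint.const_mul _) (integrable_const 1), integral_const_mul] at h1
    simp only [integral_const, probReal_univ, smul_eq_mul, mul_one] at h1
    have : (a + 1 / a) * ∫ z, t z ∂μ ≤ (a + 1 / a) * 1 :=
      mul_le_mul_of_nonneg_left hm (by positivity)
    linarith
  refine ⟨t, htm, ht0, hta, hm, hsq, fun φ hφ hφ1 => ?_⟩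
  have hrt : ∀ z, ENNReal.ofReal (r z) = ENNReal.ofReal (r z - t z) + ENNReal.ofReal (t z) := by
    intro z
    rw [← ENNReal.ofReal_add (sub_nonneg.2 (htr z)) (ht0 z)]; simp
  have hrtint : Integrable (fun z => r z - t z) μ := hrint.sub htint
  have hrtm : Measurable fun z => ENNReal.ofReal (r z - t z) * φ z :=
    (hrm.sub htm).ennreal_ofReal.mul hφ
  calc ∫⁻ z, φ z ∂ν
      = ∫⁻ z, φ z ∂ρ + ∫⁻ z, ENNReal.ofReal (r z) * φ z ∂μ := by
        conv_lhs => rw [hdec]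
        rw [lintegral_add_measure,
          lintegral_withDensity_eq_lintegral_mul _ hrm.ennreal_ofReal hφ]
        rfl
    _ = ∫⁻ z, φ z ∂ρ + (∫⁻ z, ENNReal.ofReal (r z - t z) * φ z ∂μ
          + ∫⁻ z, φ z * ENNReal.ofReal (t z) ∂μ) := by
        rw [← lintegral_add_left hrtm]
        congr 2
        ext z
        rw [hrt z, add_mul, mul_comm (φ z)]
    _ ≤ ρ Set.univ + (∫⁻ z, ENNReal.ofReal (r z - t z) ∂μ
          + ∫⁻ z, φ z * ENNReal.ofReal (t z) ∂μ) := by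
        gcongr
        · calc ∫⁻ z, φ z ∂ρ ≤ ∫⁻ _, 1 ∂ρ := lintegral_mono hφ1
            _ = ρ Set.univ := by simp
        · exact mul_le_of_le_one_right zero_le (hφ1 _)
    _ ≤ ENNReal.ofReal δ + ∫⁻ z, φ z * ENNReal.ofReal (t z) ∂μ := by
        rw [← add_assoc]
        gcongr
        rw [← ofReal_integral_eq_lintegral_ofReal hrtint
          (ae_of_all _ fun z => sub_nonneg.2 (htr z)), ← ofReal_measureReal,
          ← ENNReal.ofReal_add measureReal_nonneg
            (integral_nonneg fun z => sub_nonneg.2 (htr z))]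
        exact ENNReal.ofReal_le_ofReal hlost

/-- Up to mass `τ`, the measure `ν` has a subprobability density with respect to `μ` whose second
moment is at most `K`. -/
def HasSquareDensity {Z : Type*} [MeasurableSpace Z] (μ ν : Measure Z) (τ K : ENNReal) : Prop :=
  ∃ s : Z → ENNReal, Measurable s ∧ ∫⁻ z, s z ∂μ ≤ 1 ∧ ∫⁻ z, s z ^ 2 ∂μ ≤ K ∧
    ∀ φ : Z → ENNReal, Measurable φ → (∀ z, φ z ≤ 1) →
      ∫⁻ z, φ z ∂ν ≤ τ + ∫⁻ z, φ z * s z ∂μ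

/-- The density is `1 - η + η t`. Since `∫ t ≤ 1`, the terms linear in `η` cancel in the bound on
its second moment, leaving an excess quadratic in `η`. Only the `ν` component is truncated, hence
the lost mass `η δ`. -/
theorem hasSquareDensity_mixture {Z : Type*} [MeasurableSpace Z] (μ ν : Measure Z)
    [IsProbabilityMeasure μ] [IsProbabilityMeasure ν] {ε δ η : ℝ} (hη0 : 0 ≤ η) (hη1 : η ≤ 1)
    (hνμ : ∀ S, MeasurableSet S → ν.real S ≤ Real.exp ε * μ.real S + δ)
    (hμν : ∀ S, MeasurableSet S → μ.real S ≤ Real.exp ε * ν.real S + δ) :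
    HasSquareDensity μ (ENNReal.ofReal (1 - η) • μ + ENNReal.ofReal η • ν)
      (ENNReal.ofReal (η * δ))
      (ENNReal.ofReal (1 + η ^ 2 * (Real.exp ε + Real.exp (-ε) - 2 + δ))) := by
  obtain ⟨t, htm, ht0, hta, hm, hsq, hφ⟩ := exists_truncated_density μ ν hνμ hμν
  have htint : Integrable t μ := by
    refine Integrable.mono' (integrable_const (Real.exp ε)) htm.aestronglyMeasurable
      (ae_of_all _ fun z => ?_)
    rw [Real.norm_of_nonneg (ht0 z)]
    exact hta z
  have ht2int : Integrable (fun z => t z ^ 2) μ := by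
    refine Integrable.mono' (integrable_const (Real.exp ε ^ 2))
      (htm.pow_const 2).aestronglyMeasurable (ae_of_all _ fun z => ?_)
    rw [Real.norm_of_nonneg (sq_nonneg _)]
    exact pow_le_pow_left₀ (ht0 z) (hta z) 2
  have hη' : 0 ≤ 1 - η := sub_nonneg.2 hη1
  have hs0 : ∀ z, 0 ≤ 1 - η + η * t z := fun z => add_nonneg hη' (mul_nonneg hη0 (ht0 z))
  have hsm : Measurable fun z => 1 - η + η * t z := (htm.const_mul η).const_add _
  have hsint : Integrable (fun z => 1 - η + η * t z) μ :=
    (integrable_const _).add (htint.const_mul η)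
  refine ⟨fun z => ENNReal.ofReal (1 - η + η * t z), hsm.ennreal_ofReal, ?_, ?_, ?_⟩
  · rw [← ofReal_integral_eq_lintegral_ofReal hsint (ae_of_all _ hs0),
      integral_add (integrable_const _) (htint.const_mul η), integral_const_mul]
    simp only [integral_const, probReal_univ, smul_eq_mul, one_mul]
    rw [← ENNReal.ofReal_one]
    exact ENNReal.ofReal_le_ofReal (by nlinarith)
  · have hexp : ∀ z, (1 - η + η * t z) ^ 2 =
        (1 - η) ^ 2 + 2 * η * (1 - η) * t z + η ^ 2 * t z ^ 2 := fun z => by ring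
    have hlin : Integrable (fun z => (1 - η) ^ 2 + 2 * η * (1 - η) * t z) μ :=
      (integrable_const _).add (htint.const_mul _)
    have hint : Integrable (fun z => (1 - η + η * t z) ^ 2) μ := by
      simp_rw [hexp]
      exact hlin.add (ht2int.const_mul _)
    simp_rw [← ENNReal.ofReal_pow (hs0 _)]
    rw [← ofReal_integral_eq_lintegral_ofReal hint (ae_of_all _ fun z => sq_nonneg _)]
    refine ENNReal.ofReal_le_ofReal ?_
    simp_rw [hexp]
    rw [integral_add hlin (ht2int.const_mul _),
      integral_add (integrable_const _) (htint.const_mul _), integral_const_mul,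
      integral_const_mul]
    simp only [integral_const, probReal_univ, smul_eq_mul, one_mul]
    have h1 : 2 * η * (1 - η) * ∫ z, t z ∂μ ≤ 2 * η * (1 - η) * 1 :=
      mul_le_mul_of_nonneg_left hm (by positivity)
    have h2 := mul_le_mul_of_nonneg_left hsq (sq_nonneg η)
    nlinarith
  · intro φ hφm hφ1
    have hsplit : ∀ z, φ z * ENNReal.ofReal (1 - η + η * t z) =
        ENNReal.ofReal (1 - η) * φ z + ENNReal.ofReal η * (φ z * ENNReal.ofReal (t z)) := by
      intro z
      rw [ENNReal.ofReal_add hη' (mul_nonneg hη0 (ht0 z)), ENNReal.ofReal_mul hη0]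
      ring
    have hφt : Measurable fun z => φ z * ENNReal.ofReal (t z) := hφm.mul htm.ennreal_ofReal
    simp_rw [hsplit]
    rw [lintegral_add_left (hφm.const_mul _), lintegral_const_mul _ hφm,
      lintegral_const_mul _ hφt, lintegral_add_measure,
      lintegral_smul_measure, lintegral_smul_measure, ENNReal.ofReal_mul hη0]
    calc _ ≤ ENNReal.ofReal (1 - η) • ∫⁻ z, φ z ∂μ + ENNReal.ofReal η •
          (ENNReal.ofReal δ + ∫⁻ z, φ z * ENNReal.ofReal (t z) ∂μ) := by
          gcongr
          exact hφ φ hφm hφ1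
      _ = _ := by simp only [smul_eq_mul]; ring

/-! ### Tensorization over the users -/

theorem sq_lintegral_mul_le {Z : Type*} [MeasurableSpace Z] (μ : Measure Z) {f g : Z → ENNReal}
    (hf : Measurable f) (hg : Measurable g) :
    (∫⁻ z, f z * g z ∂μ) ^ 2 ≤ (∫⁻ z, f z ^ 2 ∂μ) * ∫⁻ z, g z ^ 2 ∂μ := by
  have h := ENNReal.lintegral_mul_le_Lp_mul_Lq μ Real.HolderConjugate.two_two hf.aemeasurable
    hg.aemeasurable
  have h2 := pow_le_pow_left₀ zero_le h 2
  have hpow : ∀ x : ENNReal, (x ^ (1 / (2 : ℝ))) ^ 2 = x := fun x => by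
    rw [← ENNReal.rpow_two, ← ENNReal.rpow_mul]; simp
  simpa only [Pi.mul_apply, mul_pow, hpow, ENNReal.rpow_two] using h2

theorem measurable_finCons {n : ℕ} {Z : Type*} [MeasurableSpace Z] :
    Measurable fun p : Z × (Fin n → Z) => (Fin.cons p.1 p.2 : Fin (n + 1) → Z) := by
  refine measurable_pi_iff.2 fun i => ?_
  refine Fin.cases ?_ (fun j => ?_) i
  · simpa using measurable_fst
  · simp only [Fin.cons_succ]
    exact (measurable_pi_apply j).comp measurable_snd

theorem lintegral_pi_succ {n : ℕ} {Z : Type*} [MeasurableSpace Z]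
    (μ : Fin (n + 1) → Measure Z) [∀ i, IsProbabilityMeasure (μ i)]
    {φ : (Fin (n + 1) → Z) → ENNReal} (hφ : Measurable φ) :
    ∫⁻ z, φ z ∂(Measure.pi μ) =
      ∫⁻ y, ∫⁻ x, φ (Fin.cons x y) ∂(μ 0) ∂(Measure.pi fun i : Fin n => μ i.succ) := by
  have hmp := (measurePreserving_piFinSuccAbove μ 0).symm
  have hφc : Measurable fun p : Z × (Fin n → Z) => φ (Fin.cons p.1 p.2) := hφ.comp measurable_finCons
  rw [← hmp.lintegral_comp hφ]
  have : (fun p : Z × (Fin n → Z) =>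
      φ ((MeasurableEquiv.piFinSuccAbove (fun _ => Z) 0).symm p)) =
      fun p => φ (Fin.cons p.1 p.2) := by
    ext p
    simp [MeasurableEquiv.piFinSuccAbove, Fin.insertNthEquiv]
  erw [this]
  rw [lintegral_prod_symm _ hφc.aemeasurable]
  rfl

/-- Tensorization: a test against a product measure `⨂ νᵢ` is controlled by its second moment
under `⨂ μᵢ`. -/
theorem exists_lintegral_pi_le {Z : Type*} [MeasurableSpace Z] {τ K : ENNReal} (n : ℕ)
    (μ ν : Fin n → Measure Z) [∀ i, IsProbabilityMeasure (μ i)]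
    [∀ i, IsProbabilityMeasure (ν i)] (h : ∀ i, HasSquareDensity (μ i) (ν i) τ K)
    (φ : (Fin n → Z) → ENNReal) (hφ : Measurable φ) (hφ1 : ∀ z, φ z ≤ 1) :
    ∃ x : ENNReal, ∫⁻ z, φ z ∂(Measure.pi ν) ≤ n * τ + x ∧
      x ^ 2 ≤ K ^ n * ∫⁻ z, φ z ^ 2 ∂(Measure.pi μ) := by
  induction n with
  | zero =>
    refine ⟨∫⁻ z, φ z ∂(Measure.pi ν), by simp, ?_⟩
    rw [Measure.pi_of_empty ν, Measure.pi_of_empty μ, lintegral_dirac' _ hφ,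
      lintegral_dirac' _ (hφ.pow_const 2)]
    simp
  | succ n ih =>
    obtain ⟨s, hsm, hs1, hsK, hs⟩ := h 0
    have hφc : Measurable fun p : (Fin n → Z) × Z => φ (Fin.cons p.2 p.1) :=
      hφ.comp (measurable_finCons.comp measurable_swap)
    have hsec : ∀ y, Measurable fun x => φ (Fin.cons x y) := fun y =>
      hφc.comp measurable_prodMk_left
    -- Integrating out the first report against its density leaves a test on the other reports. It
    -- is again bounded by 1 because `s` has mass at most 1, so the induction hypothesis applies.
    set ψ : (Fin n → Z) → ENNReal := fun y => ∫⁻ x, φ (Fin.cons x y) * s x ∂(μ 0) with hψ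
    have hψm : Measurable ψ := (hφc.mul (hsm.comp measurable_snd)).lintegral_prod_right'
    have hψ1 : ∀ y, ψ y ≤ 1 := fun y =>
      (lintegral_mono fun x => mul_le_of_le_one_left zero_le (hφ1 _)).trans hs1
    obtain ⟨x, hx, hx2⟩ := ih (fun i => μ i.succ) (fun i => ν i.succ) (fun i => h i.succ) ψ hψm hψ1
    refine ⟨x, ?_, ?_⟩
    · rw [lintegral_pi_succ ν hφ]
      calc _ ≤ ∫⁻ y, (τ + ψ y) ∂(Measure.pi fun i : Fin n => ν i.succ) :=
            lintegral_mono fun y => hs _ (hsec y) fun _ => hφ1 _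
        _ = τ + ∫⁻ y, ψ y ∂(Measure.pi fun i : Fin n => ν i.succ) := by
            rw [lintegral_add_left measurable_const]; simp
        _ ≤ τ + (n * τ + x) := by gcongr
        _ = _ := by push_cast; ring
    · rw [lintegral_pi_succ μ (hφ.pow_const 2)]
      calc x ^ 2 ≤ K ^ n * ∫⁻ y, ψ y ^ 2 ∂(Measure.pi fun i : Fin n => μ i.succ) := hx2
        _ ≤ K ^ n * ∫⁻ y, K * ∫⁻ x, φ (Fin.cons x y) ^ 2 ∂(μ 0)
              ∂(Measure.pi fun i : Fin n => μ i.succ) := by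
            gcongr with y
            refine (sq_lintegral_mul_le _ (hsec y) hsm).trans ?_
            rw [mul_comm]
            gcongr
        _ = _ := by
            rw [lintegral_const_mul _ (hφc.pow_const 2).lintegral_prod_right', pow_succ, mul_assoc]

/-! ### The error functional and the law of the reports -/

theorem freq_nonneg {n d : ℕ} (v : Fin n → Fin d) (u : Fin d) : 0 ≤ freq v u := by
  unfold freq; positivity

theorem freq_le_one {n d : ℕ} (v : Fin n → Fin d) (u : Fin d) : freq v u ≤ 1 := by
  unfold freq
  refine div_le_one_of_le₀ ?_ (Nat.cast_nonneg n)
  exact_mod_cast (Finset.card_filter_le _ _).trans (by simp)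

theorem linfError_nonneg {d : ℕ} (f : Fin d → ℝ) (g : Fin d → Set.Icc (0 : ℝ) 1) :
    0 ≤ linfError f g := norm_nonneg _

theorem abs_sub_le_linfError {d : ℕ} (f : Fin d → ℝ) (g : Fin d → Set.Icc (0 : ℝ) 1)
    (u : Fin d) : |(g u : ℝ) - f u| ≤ linfError f g :=
  norm_le_pi_norm ((fun u => (g u : ℝ)) - f) u

theorem linfError_freq_le_one {n d : ℕ} (v : Fin n → Fin d) (g : Fin d → Set.Icc (0 : ℝ) 1) :
    linfError (freq v) g ≤ 1 := by
  refine (pi_norm_le_iff_of_nonneg zero_le_one).2 fun u => ?_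
  simp only [Pi.sub_apply, Real.norm_eq_abs, abs_le]
  constructor <;> linarith [(g u).2.1, (g u).2.2, freq_nonneg v u, freq_le_one v u]

theorem measurable_linfError {d : ℕ} (f : Fin d → ℝ) : Measurable (linfError f) := by
  unfold linfError
  fun_prop

/-- All integrands are measurable with values in `[0, 1]`, so none of the nested Bochner integrals
takes the default value 0. -/
theorem ofReal_expectedError {n d : ℕ} {Z : Type*} [MeasurableSpace Z] (P : Measure (Fin d))
    [IsProbabilityMeasure P] (Q : Fin n → Kernel (Fin d) Z) [∀ i, IsMarkovKernel (Q i)]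
    (B : Kernel (Fin n → Z) (Fin d → Set.Icc (0 : ℝ) 1)) [IsMarkovKernel B] :
    ENNReal.ofReal (expectedError P Q B) =
      ∫⁻ v, ∫⁻ z, ∫⁻ g, ENNReal.ofReal (linfError (freq v) g) ∂(B z)
        ∂(Measure.pi fun i => Q i (v i)) ∂(Measure.pi fun _ : Fin n => P) := by
  have hint : ∀ (v : Fin n → Fin d) z, Integrable (linfError (freq v)) (B z) := fun v z =>
    Integrable.of_bound (measurable_linfError _).aestronglyMeasurable 1 (ae_of_all _ fun g => by
      rw [Real.norm_of_nonneg (linfError_nonneg _ _)]; exact linfError_freq_le_one v g)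
  have h0 : ∀ (v : Fin n → Fin d) z, 0 ≤ ∫ g, linfError (freq v) g ∂(B z) := fun v z =>
    integral_nonneg fun g => linfError_nonneg _ _
  have h1 : ∀ (v : Fin n → Fin d) z, ∫ g, linfError (freq v) g ∂(B z) ≤ 1 := fun v z => by
    have := integral_mono (hint v z) (integrable_const 1) (linfError_freq_le_one v)
    simpa using this
  have hint2 : ∀ (v : Fin n → Fin d), Integrable (fun z => ∫ g, linfError (freq v) g ∂(B z))
      (Measure.pi fun i => Q i (v i)) := fun v => by
    refine Integrable.of_bound ?_ 1 (ae_of_all _ fun z => ?_)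
    · exact (measurable_linfError (freq v)).stronglyMeasurable.integral_kernel.aestronglyMeasurable
    · rw [Real.norm_of_nonneg (h0 v z)]; exact h1 v z
  unfold expectedError
  rw [ofReal_integral_eq_lintegral_ofReal Integrable.of_finite
    (ae_of_all _ fun v => integral_nonneg (h0 v))]
  refine lintegral_congr fun v => ?_
  rw [ofReal_integral_eq_lintegral_ofReal (hint2 v) (ae_of_all _ (h0 v))]
  refine lintegral_congr fun z => ?_
  rw [ofReal_integral_eq_lintegral_ofReal (hint v z) (ae_of_all _ fun g => linfError_nonneg _ _)]

theorem lintegral_pi_prod {n : ℕ} {Z : Type*} [MeasurableSpace Z]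
    (μ : Fin n → Measure Z) [∀ i, IsProbabilityMeasure (μ i)]
    (f : Fin n → Z → ENNReal) (hf : ∀ i, Measurable (f i)) :
    ∫⁻ z, ∏ i, f i (z i) ∂(Measure.pi μ) = ∏ i, ∫⁻ x, f i x ∂(μ i) := by
  induction n with
  | zero => simp
  | succ n ih =>
    have hm : Measurable fun z : Fin (n + 1) → Z => ∏ i, f i (z i) :=
      Finset.measurable_prod _ fun i _ => (hf i).comp (measurable_pi_apply i)
    rw [lintegral_pi_succ μ hm, Fin.prod_univ_succ,
      ← ih (fun i => μ i.succ) (fun i => f i.succ) fun i => hf i.succ,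
      ← lintegral_const_mul _ (Finset.measurable_prod _ fun i _ =>
        (hf i.succ).comp (measurable_pi_apply i))]
    refine lintegral_congr fun y => ?_
    simp_rw [Fin.prod_univ_succ, Fin.cons_zero, Fin.cons_succ]
    rw [lintegral_mul_const _ (hf 0)]

/-- The reports of i.i.d. items are independent. -/
theorem lintegral_reports {n d : ℕ} {Z : Type*} [MeasurableSpace Z] (P : Measure (Fin d))
    [IsProbabilityMeasure P] (Q : Fin n → Kernel (Fin d) Z) [∀ i, IsMarkovKernel (Q i)]
    {φ : (Fin n → Z) → ENNReal} (hφ : Measurable φ) :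
    ∫⁻ v, ∫⁻ z, φ z ∂(Measure.pi fun i => Q i (v i)) ∂(Measure.pi fun _ : Fin n => P) =
      ∫⁻ z, φ z ∂(Measure.pi fun i => P.bind (Q i)) := by
  have hmeas : Measurable fun v : Fin n → Fin d => Measure.pi fun i => Q i (v i) :=
    measurable_of_finite _
  rw [← Measure.lintegral_bind hmeas.aemeasurable hφ.aemeasurable]
  congr 1
  symm
  refine Measure.pi_eq fun s hs => ?_
  rw [Measure.bind_apply (MeasurableSet.univ_pi hs) hmeas.aemeasurable]
  simp_rw [Measure.pi_pi]
  rw [lintegral_pi_prod (fun _ => P) (fun i v => Q i v (s i)) fun i => measurable_of_finite _]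
  refine Finset.prod_congr rfl fun i _ => ?_
  rw [Measure.bind_apply (hs i) (Q i).measurable.aemeasurable]

/-! ### Spiked laws -/

/-- The law that puts mass `1 - η` on item `0` and the remaining mass `η` on item `u`. -/
noncomputable def spikedLaw {d : ℕ} [NeZero d] (η : ℝ) (u : Fin d) : Measure (Fin d) :=
  ENNReal.ofReal (1 - η) • Measure.dirac 0 + ENNReal.ofReal η • Measure.dirac u

theorem isProbabilityMeasure_spikedLaw {d : ℕ} [NeZero d] {η : ℝ} (h0 : 0 ≤ η) (h1 : η ≤ 1)
    (u : Fin d) : IsProbabilityMeasure (spikedLaw η u) := by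
  constructor
  simp [spikedLaw, ← ENNReal.ofReal_add (sub_nonneg.2 h1) h0]

theorem lintegral_spikedLaw {d : ℕ} [NeZero d] (η : ℝ) (u : Fin d) (f : Fin d → ENNReal) :
    ∫⁻ x, f x ∂(spikedLaw η u) = ENNReal.ofReal (1 - η) * f 0 + ENNReal.ofReal η * f u := by
  simp [spikedLaw, lintegral_add_measure, lintegral_smul_measure]

theorem bind_spikedLaw {d : ℕ} [NeZero d] {Z : Type*} [MeasurableSpace Z] (η : ℝ) (u : Fin d)
    (Q : Kernel (Fin d) Z) :
    (spikedLaw η u).bind Q = ENNReal.ofReal (1 - η) • Q 0 + ENNReal.ofReal η • Q u := by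
  ext s hs
  rw [Measure.bind_apply hs Q.measurable.aemeasurable, lintegral_spikedLaw]
  simp

theorem ae_spikedLaw_pi {n d : ℕ} [NeZero d] {η : ℝ} (h0 : 0 ≤ η) (h1 : η ≤ 1) (u : Fin d) :
    ∀ᵐ v ∂(Measure.pi fun _ : Fin n => spikedLaw η u), ∀ i, v i = 0 ∨ v i = u := by
  have := isProbabilityMeasure_spikedLaw h0 h1 u
  refine ae_all_iff.2 fun i => ?_
  have h : ∀ᵐ x ∂(spikedLaw η u), x = 0 ∨ x = u := by
    rw [ae_iff, ← lintegral_indicator_one (Set.toFinite _).measurableSet, lintegral_spikedLaw]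
    simp
  exact (measurePreserving_eval (fun _ : Fin n => spikedLaw η u) i).quasiMeasurePreserving.ae h

theorem hasSquareDensity_bind_spikedLaw {d : ℕ} [NeZero d] {Z : Type*} [MeasurableSpace Z]
    {ε δ η : ℝ} (h0 : 0 ≤ η) (h1 : η ≤ 1) (u : Fin d) (Q : Kernel (Fin d) Z) [IsMarkovKernel Q]
    (hQ : IsLDP ε δ Q) :
    HasSquareDensity (Q 0) ((spikedLaw η u).bind Q) (ENNReal.ofReal (η * δ))
      (ENNReal.ofReal (1 + η ^ 2 * (Real.exp ε + Real.exp (-ε) - 2 + δ))) := by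
  rw [bind_spikedLaw]
  exact hasSquareDensity_mixture _ _ h0 h1 (hQ u 0) (hQ 0 u)

/-- Chernoff bound for the lower tail of the frequency of the item `u`. -/
theorem lintegral_exp_freq_le {n d : ℕ} [NeZero d] (hn : n ≠ 0) {η : ℝ} (h0 : 0 ≤ η) (h1 : η ≤ 1)
    (u : Fin d) :
    ∫⁻ v, ENNReal.ofReal (Real.exp (n * η / 2 - n * freq v u))
      ∂(Measure.pi fun _ : Fin n => spikedLaw η u) ≤ ENNReal.ofReal (Real.exp (-(n * η / 10))) := by
  have := isProbabilityMeasure_spikedLaw h0 h1 u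
  have hrw : ∀ v : Fin n → Fin d, ENNReal.ofReal (Real.exp (n * η / 2 - n * freq v u)) =
      ENNReal.ofReal (Real.exp (n * η / 2)) *
        ∏ i, ENNReal.ofReal (Real.exp (-(if v i = u then 1 else 0))) := by
    intro v
    rw [← ENNReal.ofReal_prod_of_nonneg fun i _ => (Real.exp_pos _).le, ← Real.exp_sum,
      ← ENNReal.ofReal_mul (Real.exp_pos _).le, ← Real.exp_add]
    congr 2
    rw [Finset.sum_neg_distrib, Finset.sum_boole, freq]
    have : (n : ℝ) ≠ 0 := by exact_mod_cast hn
    field_simp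
    ring
  simp_rw [hrw]
  rw [lintegral_const_mul _ (measurable_of_finite _),
    lintegral_pi_prod (fun _ => spikedLaw η u)
      (fun _ x => ENNReal.ofReal (Real.exp (-(if x = u then 1 else 0))))
      fun _ => measurable_of_finite _,
    Finset.prod_const, Finset.card_univ, Fintype.card_fin]
  -- Here `1 - η + η / e ≤ 1 - 3η/5 ≤ exp (-3η/5)`; over `n` users the exponent becomes `nη/2 -
  -- 3nη/5 = -nη/10`.
  have hone : ∫⁻ x, ENNReal.ofReal (Real.exp (-(if x = u then 1 else 0))) ∂(spikedLaw η u) ≤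
      ENNReal.ofReal (Real.exp (-(3 * η / 5))) := by
    rw [lintegral_spikedLaw, ← ENNReal.ofReal_mul (sub_nonneg.2 h1), ← ENNReal.ofReal_mul h0,
      ← ENNReal.ofReal_add (mul_nonneg (sub_nonneg.2 h1) (Real.exp_pos _).le)
        (mul_nonneg h0 (Real.exp_pos _).le)]
    refine ENNReal.ofReal_le_ofReal ?_
    have hle : Real.exp (-(if (0 : Fin d) = u then 1 else 0)) ≤ 1 := by
      rw [Real.exp_le_one_iff]; split_ifs <;> norm_num
    have he : Real.exp (-1) < 2 / 5 := by linarith [Real.exp_neg_one_lt_d9]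
    have := Real.add_one_le_exp (-(3 * η / 5))
    simp only [if_true]
    nlinarith
  calc _ ≤ ENNReal.ofReal (Real.exp (n * η / 2)) *
        ENNReal.ofReal (Real.exp (-(3 * η / 5))) ^ n := by gcongr
    _ = _ := by
      rw [← ENNReal.ofReal_pow (Real.exp_pos _).le, ← Real.exp_nat_mul,
        ← ENNReal.ofReal_mul (Real.exp_pos _).le, ← Real.exp_add]
      congr 2
      ring

/-! ### Decoding the spike from an estimate -/

/-- The estimates that point to `u` as the only item other than `0` of frequency at least `η / 4`
(to no item, if `u = 0`). -/
def decodeSet {d : ℕ} [NeZero d] (η : ℝ) (u : Fin d) : Set (Fin d → Set.Icc (0 : ℝ) 1) :=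
  {g | ∀ w, w ≠ 0 → (η / 4 ≤ (g w : ℝ) ↔ w = u)}

theorem measurableSet_decodeSet {d : ℕ} [NeZero d] (η : ℝ) (u : Fin d) :
    MeasurableSet (decodeSet η u) := by
  unfold decodeSet
  refine measurableSet_setOfPred.2 (Measurable.forall fun w => Measurable.imp measurable_const ?_)
  refine Measurable.iff (measurableSet_setOfPred.1 ?_) measurable_const
  exact measurableSet_le measurable_const (measurable_subtype_coe.comp (measurable_pi_apply w))

theorem pairwise_disjoint_decodeSet {d : ℕ} [NeZero d] (η : ℝ) :
    Pairwise (Function.onFun Disjoint (decodeSet (d := d) η)) := by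
  have key : ∀ (u w : Fin d), u ≠ 0 → ∀ g, g ∈ decodeSet η u → g ∈ decodeSet η w → u = w :=
    fun u w hu g hgu hgw => (hgw u hu).1 ((hgu u hu).2 rfl)
  intro u w huw
  refine Set.disjoint_left.2 fun g hgu hgw => huw ?_
  by_cases hu : u = 0
  · by_cases hw : w = 0
    · rw [hu, hw]
    · exact (key w u hw g hgw hgu).symm
  · exact key u w hu g hgu hgw

/-- If decoding fails, the threshold `η / 4` is wrong at some `w ≠ 0`. For `w ≠ u` the true
frequency is 0, so the error is at least `η / 4`. For `w = u` either the frequency is at least `η /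
2`, with the same conclusion, or it is lower and the exponential is at least 1. -/
theorem one_le_error_add_decode {n d : ℕ} [NeZero d] {η : ℝ} (hη : 0 < η) (u : Fin d)
    (v : Fin n → Fin d) (hv : ∀ i, v i = 0 ∨ v i = u) (g : Fin d → Set.Icc (0 : ℝ) 1) :
    1 ≤ ENNReal.ofReal (4 / η) * ENNReal.ofReal (linfError (freq v) g) +
      (decodeSet η u).indicator 1 g + ENNReal.ofReal (Real.exp (n * η / 2 - n * freq v u)) := by
  by_cases hg : g ∈ decodeSet η u
  · rw [Set.indicator_of_mem hg]
    exact le_add_right le_add_self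
  have herr : ∀ w, η / 4 ≤ |(g w : ℝ) - freq v w| →
      1 ≤ ENNReal.ofReal (4 / η) * ENNReal.ofReal (linfError (freq v) g) := by
    intro w hw
    rw [← ENNReal.ofReal_mul (by positivity), ENNReal.one_le_ofReal]
    have := hw.trans (abs_sub_le_linfError (freq v) g w)
    calc (1 : ℝ) = 4 / η * (η / 4) := by field_simp
      _ ≤ _ := by gcongr
  simp only [decodeSet, Set.mem_ofPred_eq, not_forall] at hg
  obtain ⟨w, hw0, hw⟩ := hg
  by_cases hwu : w = u
  · have hlt : (g w : ℝ) < η / 4 := by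
      by_contra h
      exact hw ⟨fun _ => hwu, fun _ => not_lt.1 h⟩
    rcases le_total (η / 2) (freq v u) with hf | hf
    · refine le_add_right (le_add_right (herr w ?_))
      rw [abs_sub_comm]
      refine le_trans ?_ (le_abs_self _)
      rw [hwu] at hlt ⊢
      linarith
    · refine le_add_left ?_
      rw [ENNReal.one_le_ofReal, Real.one_le_exp_iff]
      have : (0 : ℝ) ≤ n := Nat.cast_nonneg n
      nlinarith
  · have hle : η / 4 ≤ (g w : ℝ) := by
      by_contra h
      exact hw ⟨fun h' => absurd h' h, fun h' => absurd h' hwu⟩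
    refine le_add_right (le_add_right (herr w ?_))
    have hf : freq v w = 0 := by
      have : (Finset.univ.filter fun i => v i = w) = ∅ := by
        refine Finset.filter_eq_empty_iff.2 fun i _ hi => ?_
        rcases hv i with h | h
        · exact hw0 (hi.symm.trans h)
        · exact hwu (hi.symm.trans h)
      simp [freq, this]
    rw [hf, sub_zero]
    exact hle.trans (le_abs_self _)

theorem one_le_expectedError_add_decode {n d : ℕ} [NeZero d] (hn : n ≠ 0) {Z : Type*}
    [MeasurableSpace Z] {η : ℝ} (h0 : 0 < η) (h1 : η ≤ 1) (u : Fin d)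
    (Q : Fin n → Kernel (Fin d) Z) [∀ i, IsMarkovKernel (Q i)]
    (B : Kernel (Fin n → Z) (Fin d → Set.Icc (0 : ℝ) 1)) [IsMarkovKernel B] :
    1 ≤ ENNReal.ofReal (4 / η) * ENNReal.ofReal (expectedError (spikedLaw η u) Q B) +
      ∫⁻ z, B z (decodeSet η u) ∂(Measure.pi fun i => (spikedLaw η u).bind (Q i)) +
      ENNReal.ofReal (Real.exp (-(n * η / 10))) := by
  have := isProbabilityMeasure_spikedLaw h0.le h1 u
  have hD := measurableSet_decodeSet (d := d) η u
  have hE : ∀ v : Fin n → Fin d, Measurable fun g => ENNReal.ofReal (linfError (freq v) g) :=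
    fun v => (measurable_linfError _).ennreal_ofReal
  have hBD : Measurable fun z => B z (decodeSet η u) := B.measurable_coe hD
  have hinner : ∀ᵐ v ∂(Measure.pi fun _ : Fin n => spikedLaw η u), 1 ≤
      ENNReal.ofReal (4 / η) * (∫⁻ z, ∫⁻ g, ENNReal.ofReal (linfError (freq v) g) ∂(B z)
        ∂(Measure.pi fun i => Q i (v i))) +
      (∫⁻ z, B z (decodeSet η u) ∂(Measure.pi fun i => Q i (v i))) +
      ENNReal.ofReal (Real.exp (n * η / 2 - n * freq v u)) := by
    filter_upwards [ae_spikedLaw_pi h0.le h1 u] with v hv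
    have hz : ∀ z, 1 ≤ ENNReal.ofReal (4 / η) *
        (∫⁻ g, ENNReal.ofReal (linfError (freq v) g) ∂(B z)) + B z (decodeSet η u) +
        ENNReal.ofReal (Real.exp (n * η / 2 - n * freq v u)) := by
      intro z
      calc 1 = ∫⁻ _, 1 ∂(B z) := by simp
        _ ≤ _ := lintegral_mono fun g => one_le_error_add_decode h0 u v hv g
        _ = _ := by
          rw [lintegral_add_right _ measurable_const,
            lintegral_add_right _ (measurable_one.indicator hD),
            lintegral_const_mul _ (hE v), lintegral_indicator_one hD]
          simp
    calc 1 = ∫⁻ _, 1 ∂(Measure.pi fun i => Q i (v i)) := by simp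
      _ ≤ _ := lintegral_mono hz
      _ = _ := by
        rw [lintegral_add_right _ measurable_const, lintegral_add_right _ hBD,
          lintegral_const_mul _ (hE v).lintegral_kernel]
        simp
  calc 1 = ∫⁻ _, 1 ∂(Measure.pi fun _ : Fin n => spikedLaw η u) := by simp
    _ ≤ _ := lintegral_mono_ae hinner
    _ = _ + _ + _ := by
      rw [lintegral_add_right _ (measurable_of_finite _),
        lintegral_add_right _ (measurable_of_finite _),
        lintegral_const_mul _ (measurable_of_finite _), ← ofReal_expectedError,
        lintegral_reports _ _ hBD]
    _ ≤ _ := by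
      gcongr
      exact lintegral_exp_freq_le hn h0.le h1 u

theorem expectedError_nonneg {n d : ℕ} {Z : Type*} [MeasurableSpace Z] (P : Measure (Fin d))
    (Q : Fin n → Kernel (Fin d) Z) (B : Kernel (Fin n → Z) (Fin d → Set.Icc (0 : ℝ) 1)) :
    0 ≤ expectedError P Q B :=
  integral_nonneg fun _ => integral_nonneg fun _ => integral_nonneg fun _ => linfError_nonneg _ _

/-- Pigeonhole over the disjoint decoding events. The candidate `u = 0` (no spike) is kept, so that
there are `d` hypotheses rather than `d - 1`. -/
theorem exists_expectedError_spikedLaw_ge {n d : ℕ} [NeZero d] (hn : n ≠ 0) {Z : Type*}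
    [MeasurableSpace Z] {ε δ η : ℝ} (hδ : 0 ≤ δ) (h0 : 0 < η) (h1 : η ≤ 1)
    (Q : Fin n → Kernel (Fin d) Z) [∀ i, IsMarkovKernel (Q i)] (hQ : ∀ i, IsLDP ε δ (Q i))
    (B : Kernel (Fin n → Z) (Fin d → Set.Icc (0 : ℝ) 1)) [IsMarkovKernel B] {b : ℝ} (hb : 0 ≤ b)
    (hbK : (1 + η ^ 2 * (Real.exp ε + Real.exp (-ε) - 2 + δ)) ^ n ≤ d * b ^ 2) :
    ∃ u : Fin d, 1 - n * (η * δ) - Real.exp (-(n * η / 10)) - b ≤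
      4 / η * expectedError (spikedLaw η u) Q B := by
  set k := 1 + η ^ 2 * (Real.exp ε + Real.exp (-ε) - 2 + δ) with hk
  have hk0 : 0 ≤ k := by
    have : 2 ≤ Real.exp ε + Real.exp (-ε) := by
      linarith [Real.add_one_le_exp ε, Real.add_one_le_exp (-ε)]
    have : 0 ≤ η ^ 2 * (Real.exp ε + Real.exp (-ε) - 2 + δ) :=
      mul_nonneg (sq_nonneg _) (by linarith)
    linarith
  set μ := Measure.pi fun i => Q i 0 with hμ
  have hBm : ∀ u, Measurable fun z => B z (decodeSet η u) := fun u =>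
    B.measurable_coe (measurableSet_decodeSet η u)
  have hB1 : ∀ u z, B z (decodeSet η u) ≤ 1 := fun u z => prob_le_one
  -- The reference law does not depend on `u`, and squaring a probability only lowers it, so
  -- disjointness gives `∑ q u ≤ 1`.
  set q : Fin d → ENNReal := fun u => ∫⁻ z, B z (decodeSet η u) ^ 2 ∂μ with hq
  have hqsum : ∑ u, q u ≤ 1 := by
    calc ∑ u, q u ≤ ∑ u, ∫⁻ z, B z (decodeSet η u) ∂μ := by
          refine Finset.sum_le_sum fun u _ => lintegral_mono fun z => ?_
          rw [sq]
          exact mul_le_of_le_one_left zero_le (hB1 u z)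
      _ = ∫⁻ z, ∑ u, B z (decodeSet η u) ∂μ := (lintegral_finsetSum _ fun u _ => hBm u).symm
      _ ≤ ∫⁻ _, 1 ∂μ := by
          refine lintegral_mono fun z => ?_
          rw [← tsum_fintype (L := .unconditional _),
            ← measure_iUnion (pairwise_disjoint_decodeSet η) (measurableSet_decodeSet η)]
          exact prob_le_one
      _ = 1 := by simp
  have hqtop : ∀ u, q u ≠ ⊤ := fun u =>
    ((Finset.single_le_sum (fun _ _ => zero_le) (Finset.mem_univ u)).trans hqsum).trans_lt
      ENNReal.one_lt_top |>.ne
  have hx : ∀ u, ∃ x : ℝ, 0 ≤ x ∧ 1 ≤ 4 / η * expectedError (spikedLaw η u) Q B +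
      (n * (η * δ) + x) + Real.exp (-(n * η / 10)) ∧ x ^ 2 ≤ k ^ n * (q u).toReal := by
    intro u
    have := isProbabilityMeasure_spikedLaw h0.le h1 u
    have : ∀ i, IsProbabilityMeasure ((spikedLaw η u).bind (Q i)) := fun i => inferInstance
    obtain ⟨x, hx, hx2⟩ := exists_lintegral_pi_le n (fun i => Q i 0)
      (fun i => (spikedLaw η u).bind (Q i))
      (fun i => hasSquareDensity_bind_spikedLaw h0.le h1 u (Q i) (hQ i)) _ (hBm u) (hB1 u)
    have hx2' : x ^ 2 ≤ ENNReal.ofReal k ^ n * q u := hx2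
    have hxt : x ≠ ⊤ := by
      rintro rfl
      have : ENNReal.ofReal k ^ n * q u ≠ ⊤ :=
        ENNReal.mul_ne_top (ENNReal.pow_ne_top ENNReal.ofReal_ne_top) (hqtop u)
      exact this (top_le_iff.1 (by simpa using hx2'))
    have hE0 := expectedError_nonneg (spikedLaw η u) Q B
    refine ⟨x.toReal, ENNReal.toReal_nonneg, ?_, ?_⟩
    · have h := (one_le_expectedError_add_decode hn h0 h1 u Q B).trans
        (add_le_add_left (add_le_add_right hx _) _)
      have hnn : (0 : ℝ) ≤ n * (η * δ) := by positivity
      rw [← ENNReal.one_le_ofReal, ENNReal.ofReal_add (by positivity) (Real.exp_pos _).le,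
        ENNReal.ofReal_add (by positivity) (by positivity),
        ENNReal.ofReal_add hnn ENNReal.toReal_nonneg, ENNReal.ofReal_toReal hxt,
        ENNReal.ofReal_mul (by positivity), ENNReal.ofReal_mul (Nat.cast_nonneg n),
        ENNReal.ofReal_natCast]
      exact h
    · have := ENNReal.toReal_mono
        (ENNReal.mul_ne_top (ENNReal.pow_ne_top ENNReal.ofReal_ne_top) (hqtop u)) hx2'
      rwa [ENNReal.toReal_pow, ENNReal.toReal_mul, ENNReal.toReal_pow,
        ENNReal.toReal_ofReal hk0] at this
  choose x hx0 hx1 hx2 using hx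
  -- If every `u` failed, all `x u` would exceed `b`, and `∑ x u ^ 2` would exceed `d * b ^ 2 ≥ k ^
  -- n`.
  by_contra! hcon
  have hbx : ∀ u, b ^ 2 < x u ^ 2 := fun u => by
    have : b < x u := by linarith [hcon u, hx1 u]
    exact pow_lt_pow_left₀ this hb two_ne_zero
  have hsum : ∑ _u : Fin d, b ^ 2 < ∑ u, x u ^ 2 :=
    Finset.sum_lt_sum_of_nonempty Finset.univ_nonempty fun u _ => hbx u
  have hle : ∑ u, x u ^ 2 ≤ k ^ n := by
    calc ∑ u, x u ^ 2 ≤ ∑ u, k ^ n * (q u).toReal := Finset.sum_le_sum fun u _ => hx2 u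
      _ = k ^ n * (∑ u, q u).toReal := by
        rw [← Finset.mul_sum, ENNReal.toReal_sum fun u _ => hqtop u]
      _ ≤ k ^ n * 1 := by
        refine mul_le_mul_of_nonneg_left ?_ (pow_nonneg hk0 n)
        simpa using ENNReal.toReal_mono ENNReal.one_ne_top hqsum
      _ = k ^ n := mul_one _
  simp only [Finset.sum_const, Finset.card_univ, Fintype.card_fin, nsmul_eq_mul] at hsum
  linarith

/-! ### Two-point bound for few users -/

theorem one_le_linfError_add {n d : ℕ} (hn : n ≠ 0) {u w : Fin d} (huw : u ≠ w)
    (g : Fin d → Set.Icc (0 : ℝ) 1) :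
    1 ≤ linfError (freq fun _ : Fin n => u) g + linfError (freq fun _ : Fin n => w) g := by
  have h1 := abs_sub_le_linfError (freq fun _ : Fin n => u) g u
  have h2 := abs_sub_le_linfError (freq fun _ : Fin n => w) g u
  have hn' : (n : ℝ) ≠ 0 := by exact_mod_cast hn
  have hu : freq (fun _ : Fin n => u) u = 1 := by simp [freq, hn']
  have hw : freq (fun _ : Fin n => w) u = 0 := by simp [freq, huw.symm]
  rw [hu, abs_sub_comm] at h1
  rw [hw] at h2
  linarith [le_abs_self (1 - (g u : ℝ)), le_abs_self ((g u : ℝ) - 0)]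

/-- Two constant inputs are not told apart: a bound that is exponentially small in `n`. -/
theorem expectedError_spikedLaw_half_ge {n d : ℕ} [NeZero d] (hn : n ≠ 0) {Z : Type*}
    [MeasurableSpace Z] {ε δ : ℝ} (hδ : 0 ≤ δ) (hnδ : n * δ ≤ 1 / 2) {u : Fin d} (hu : u ≠ 0)
    (Q : Fin n → Kernel (Fin d) Z) [∀ i, IsMarkovKernel (Q i)] (hQ : ∀ i, IsLDP ε δ (Q i))
    (B : Kernel (Fin n → Z) (Fin d → Set.Icc (0 : ℝ) 1)) [IsMarkovKernel B] :
    1 / (16 * (2 * (Real.exp ε + Real.exp (-ε) - 1 + δ)) ^ n) ≤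
      expectedError (spikedLaw (1 / 2) u) Q B := by
  set k := Real.exp ε + Real.exp (-ε) - 1 + δ with hk
  have hk1 : 1 ≤ k := by linarith [Real.add_one_le_exp ε, Real.add_one_le_exp (-ε)]
  set E := expectedError (spikedLaw (1 / 2) u) Q B with hE
  have hE0 : 0 ≤ E := expectedError_nonneg _ _ _
  have hP := isProbabilityMeasure_spikedLaw (d := d) (η := 1 / 2) (by norm_num) (by norm_num) u
  set φ : Fin d → (Fin n → Z) → ENNReal := fun w z =>
    ∫⁻ g, ENNReal.ofReal (linfError (freq fun _ : Fin n => w) g) ∂(B z) with hφ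
  have hlm : ∀ w, Measurable fun g =>
      ENNReal.ofReal (linfError (freq fun _ : Fin n => w) g) := fun w =>
    (measurable_linfError (d := d) _).ennreal_ofReal
  have hφm : ∀ w, Measurable (φ w) := fun w => (hlm w).lintegral_kernel
  have hφ1 : ∀ w z, φ w z ≤ 1 := fun w z => by
    calc φ w z ≤ ∫⁻ _, 1 ∂(B z) := lintegral_mono fun g => by
          rw [← ENNReal.ofReal_one]
          exact ENNReal.ofReal_le_ofReal (linfError_freq_le_one _ g)
      _ = 1 := by simp
  have hφsum : ∀ z, 1 ≤ φ u z + φ 0 z := fun z => by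
    rw [hφ, ← lintegral_add_left (hlm u)]
    calc 1 = ∫⁻ _, 1 ∂(B z) := by simp
      _ ≤ _ := lintegral_mono fun g => by
          rw [← ENNReal.ofReal_add (linfError_nonneg _ _) (linfError_nonneg _ _),
            ENNReal.one_le_ofReal]
          exact one_le_linfError_add hn hu g
  -- the two constant inputs have probability at least `2⁻ⁿ`
  have hF : ∀ w, w = 0 ∨ w = u → ∫⁻ z, φ w z ∂(Measure.pi fun i => Q i w) ≤
      ENNReal.ofReal (2 ^ n * E) := by
    intro w hw
    have hPw : ENNReal.ofReal (1 / 2) ≤ spikedLaw (1 / 2) u {w} := by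
      have : (1 - 1 / 2 : ℝ) = 1 / 2 := by norm_num
      rw [← lintegral_indicator_one (measurableSet_singleton w), lintegral_spikedLaw, this]
      rcases hw with rfl | rfl
      · exact le_add_right (by simp)
      · exact le_add_left (by simp)
    have h1 : (∫⁻ z, φ w z ∂(Measure.pi fun i => Q i w)) * ENNReal.ofReal (1 / 2) ^ n ≤
        ENNReal.ofReal E := by
      rw [hE, ofReal_expectedError]
      calc _ ≤ (∫⁻ z, φ w z ∂(Measure.pi fun i => Q i w)) *
            (Measure.pi fun _ : Fin n => spikedLaw (1 / 2) u) {fun _ => w} := by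
            gcongr
            rw [Measure.pi_singleton, Finset.prod_const, Finset.card_univ, Fintype.card_fin]
            gcongr
        _ = ∫⁻ v in {fun _ => w}, ∫⁻ z, ∫⁻ g, ENNReal.ofReal (linfError (freq v) g) ∂(B z)
              ∂(Measure.pi fun i => Q i (v i)) ∂(Measure.pi fun _ => spikedLaw (1 / 2) u) := by
            rw [lintegral_singleton]
        _ ≤ _ := setLIntegral_le_lintegral _ _
    have h2 : ENNReal.ofReal (1 / 2) ^ n * ENNReal.ofReal (2 ^ n) = 1 := by
      rw [← ENNReal.ofReal_pow (by norm_num), ← ENNReal.ofReal_mul (by positivity), ← mul_pow]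
      norm_num
    calc _ = (∫⁻ z, φ w z ∂(Measure.pi fun i => Q i w)) * ENNReal.ofReal (1 / 2) ^ n *
          ENNReal.ofReal (2 ^ n) := by rw [mul_assoc, h2, mul_one]
      _ ≤ ENNReal.ofReal E * ENNReal.ofReal (2 ^ n) := by gcongr
      _ = _ := by rw [← ENNReal.ofReal_mul hE0, mul_comm]
  -- The mixture with `η = 1` is `Q i u` itself.
  have hsd : ∀ i, HasSquareDensity (Q i 0) (Q i u) (ENNReal.ofReal δ) (ENNReal.ofReal k) := by
    intro i
    have h := hasSquareDensity_mixture (Q i 0) (Q i u) (η := 1) zero_le_one le_rfl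
      (hQ i u 0) (hQ i 0 u)
    have hk' : 1 + 1 ^ 2 * (Real.exp ε + Real.exp (-ε) - 2 + δ) = k := by rw [hk]; ring
    rw [hk'] at h
    simpa using h
  obtain ⟨x, hx, hx2⟩ := exists_lintegral_pi_le n (fun i => Q i 0) (fun i => Q i u) hsd
    (φ 0) (hφm 0) (hφ1 0)
  have hx2' : x ^ 2 ≤ ENNReal.ofReal (k ^ n * (2 ^ n * E)) := by
    rw [ENNReal.ofReal_mul (by positivity), ENNReal.ofReal_pow (by linarith)]
    refine hx2.trans ?_
    gcongr
    refine (lintegral_mono fun z => ?_).trans (hF 0 (Or.inl rfl))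
    rw [sq]
    exact mul_le_of_le_one_left zero_le (hφ1 0 z)
  have hxt : x ≠ ⊤ := by
    rintro rfl
    simp at hx2'
  have hX2 : x.toReal ^ 2 ≤ k ^ n * (2 ^ n * E) := by
    have := ENNReal.toReal_mono ENNReal.ofReal_ne_top hx2'
    rwa [ENNReal.toReal_pow, ENNReal.toReal_ofReal (by positivity)] at this
  have hone : 1 ≤ 2 ^ n * E + (n * δ + x.toReal) := by
    rw [← ENNReal.one_le_ofReal, ENNReal.ofReal_add (by positivity) (by positivity),
      ENNReal.ofReal_add (by positivity) ENNReal.toReal_nonneg, ENNReal.ofReal_toReal hxt,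
      ENNReal.ofReal_mul (Nat.cast_nonneg n), ENNReal.ofReal_natCast]
    calc 1 = ∫⁻ _, 1 ∂(Measure.pi fun i => Q i u) := by simp
      _ ≤ ∫⁻ z, (φ u z + φ 0 z) ∂(Measure.pi fun i => Q i u) := lintegral_mono hφsum
      _ = _ + _ := lintegral_add_left (hφm u) _
      _ ≤ _ := add_le_add (hF u (Or.inr rfl)) hx
  have hkn : 1 ≤ k ^ n := one_le_pow₀ hk1
  have hy : 0 ≤ 2 ^ n * E := by positivity
  -- Either `2 ^ n * E ≥ 1/4`, or `hone` and `n * δ ≤ 1/2` leave `x ≥ 1/4`, and `hX2` bounds `x ^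
  -- 2`.
  have hfin : 1 / 16 ≤ k ^ n * (2 ^ n * E) := by
    rcases le_total (1 / 4) (2 ^ n * E) with h | h
    · nlinarith
    · have : 1 / 4 ≤ x.toReal := by linarith
      nlinarith
  have hk0 : 0 < k := by linarith
  rw [div_le_iff₀ (by positivity), mul_pow]
  nlinarith

/-! ### Choice of constants and conclusion -/

/-- The left side equals `(1 - e^{-ε})² e^ε`, and `0 ≤ 1 - e^{-ε} ≤ ε`. -/
theorem exp_add_exp_neg_sub_two_le {ε : ℝ} (hε : 0 ≤ ε) :
    Real.exp ε + Real.exp (-ε) - 2 ≤ ε ^ 2 * Real.exp ε := by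
  have h1 : Real.exp ε * Real.exp (-ε) = 1 := by rw [← Real.exp_add]; simp
  have h2 := Real.add_one_le_exp (-ε)
  have h3 : Real.exp (-ε) ≤ 1 := Real.exp_le_one_iff.2 (by linarith)
  have h4 : (1 - Real.exp (-ε)) ^ 2 ≤ ε ^ 2 := pow_le_pow_left₀ (by linarith) (by linarith) 2
  have h5 := mul_le_mul_of_nonneg_right h4 (Real.exp_pos ε).le
  have h6 : (1 - Real.exp (-ε)) ^ 2 * Real.exp ε = Real.exp ε + Real.exp (-ε) - 2 := by
    linear_combination (-2 + Real.exp (-ε)) * h1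
  linarith

/-- The case of many users. -/
theorem exists_expectedError_ge_of_large {n d : ℕ} (hn : n ≠ 0) (hd : 2 ≤ d) {Z : Type*}
    [MeasurableSpace Z] {C ε δ m : ℝ} (hε : 0 < ε) (hεC : ε ≤ C) (hδ : 0 ≤ δ)
    (hnδ : n * δ ≤ 1 / 50) (hm0 : 0 < m) (hm1 : m ≤ 1) (hm : n * (ε * m) ^ 2 ≤ Real.log d)
    (hnm : 40 ≤ n * (Real.exp (-C / 2) / 5 * m))
    (Q : Fin n → Kernel (Fin d) Z) [∀ i, IsMarkovKernel (Q i)] (hQ : ∀ i, IsLDP ε δ (Q i))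
    (B : Kernel (Fin n → Z) (Fin d → Set.Icc (0 : ℝ) 1)) [IsMarkovKernel B] :
    ∃ P : Measure (Fin d), IsProbabilityMeasure P ∧
      Real.exp (-C / 2) / 1000 * m ≤ expectedError P Q B := by
  have : NeZero d := ⟨by omega⟩
  -- The factor `e^{-C/2}` cancels the `e^C` in the bound on `e^ε + e^{-ε} - 2`, so `n η² ε² e^C = n
  -- (ε m)² / 25 ≤ log d / 25`.
  set η := Real.exp (-C / 2) / 5 * m with hη
  have hη0 : 0 < η := by positivity
  have hexp1 : Real.exp (-C / 2) ≤ 1 := Real.exp_le_one_iff.2 (by linarith)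
  have hη1 : η ≤ 1 := by
    have : Real.exp (-C / 2) / 5 ≤ 1 := by linarith
    exact mul_le_one₀ this hm0.le hm1
  have hlog2 : (0.6931 : ℝ) < Real.log d :=
    (by linarith [Real.log_two_gt_d9] : (0.6931 : ℝ) < Real.log 2).trans_le
      (Real.log_le_log (by norm_num) (by exact_mod_cast hd))
  have hd0 : (0 : ℝ) < d := by positivity
  have hn0 : (0 : ℝ) ≤ n := Nat.cast_nonneg n
  have hK : n * (η ^ 2 * (Real.exp ε + Real.exp (-ε) - 2 + δ)) ≤ Real.log d / 25 + 1 / 50 := by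
    have h1 : Real.exp ε + Real.exp (-ε) - 2 ≤ ε ^ 2 * Real.exp C :=
      (exp_add_exp_neg_sub_two_le hε.le).trans (by gcongr)
    have h2 : Real.exp (-C / 2) ^ 2 * Real.exp C = 1 := by
      rw [← Real.exp_nat_mul, ← Real.exp_add]
      simp; ring
    have h3 : n * (η ^ 2 * (ε ^ 2 * Real.exp C)) = n * (ε * m) ^ 2 / 25 := by
      rw [hη]
      linear_combination (n * m ^ 2 * ε ^ 2 / 25) * h2
    have h4 : n * (η ^ 2 * (Real.exp ε + Real.exp (-ε) - 2)) ≤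
        n * (η ^ 2 * (ε ^ 2 * Real.exp C)) := by gcongr
    have h5 : η ^ 2 * (n * δ) ≤ 1 * (n * δ) :=
      mul_le_mul_of_nonneg_right (pow_le_one₀ hη0.le hη1) (by positivity)
    linarith
  have hbK : (1 + η ^ 2 * (Real.exp ε + Real.exp (-ε) - 2 + δ)) ^ n ≤ d * (3 / 4 : ℝ) ^ 2 := by
    have h0 : 0 ≤ Real.exp ε + Real.exp (-ε) - 2 + δ := by
      linarith [Real.add_one_le_exp ε, Real.add_one_le_exp (-ε)]
    have hpos : 0 ≤ 1 + η ^ 2 * (Real.exp ε + Real.exp (-ε) - 2 + δ) := by positivity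
    have hq := Real.quadratic_le_exp_of_nonneg (x := 0.64) (by norm_num)
    -- Since `log d > 0.6931`, the exponent `log d / 25 + 1/50` is at most `log d - 0.64`, and
    -- `e^{-0.64} ≤ 9/16` allows `b = 3/4`.
    have hexp : Real.exp (-0.64) ≤ (3 / 4 : ℝ) ^ 2 := by
      rw [Real.exp_neg, inv_le_comm₀ (Real.exp_pos _) (by norm_num)]
      norm_num at hq ⊢
      linarith
    calc _ ≤ Real.exp (η ^ 2 * (Real.exp ε + Real.exp (-ε) - 2 + δ)) ^ n := by
          gcongr
          linarith [Real.add_one_le_exp (η ^ 2 * (Real.exp ε + Real.exp (-ε) - 2 + δ))]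
      _ = Real.exp (n * (η ^ 2 * (Real.exp ε + Real.exp (-ε) - 2 + δ))) :=
          (Real.exp_nat_mul _ _).symm
      _ ≤ Real.exp (Real.log d + -0.64) := Real.exp_le_exp.2 (by norm_num at hlog2 ⊢; linarith)
      _ = d * Real.exp (-0.64) := by rw [Real.exp_add, Real.exp_log hd0]
      _ ≤ _ := by gcongr
  obtain ⟨u, hu⟩ := exists_expectedError_spikedLaw_ge hn hδ hη0 hη1 Q hQ B
    (b := 3 / 4) (by norm_num) hbK
  refine ⟨spikedLaw η u, isProbabilityMeasure_spikedLaw hη0.le hη1 u, ?_⟩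
  have h1 : n * (η * δ) ≤ 1 / 50 := by
    have : η * (n * δ) ≤ 1 * (n * δ) := mul_le_mul_of_nonneg_right hη1 (by positivity)
    linarith
  have h2 : Real.exp (-(n * η / 10)) ≤ 1 / 5 := by
    refine (Real.exp_le_exp.2 (by linarith : -(n * η / 10) ≤ -4)).trans ?_
    rw [Real.exp_neg, inv_le_comm₀ (Real.exp_pos _) (by norm_num)]
    norm_num
    linarith [Real.add_one_le_exp 4]
  -- The budget is `1 - 1/50 - 1/5 - 3/4 = 3/100`.
  have h3 : 1 / 50 ≤ 4 / η * expectedError (spikedLaw η u) Q B := by linarith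
  have h4 : η / 200 ≤ expectedError (spikedLaw η u) Q B := by
    have := mul_le_mul_of_nonneg_left h3 (by positivity : 0 ≤ η / 4)
    have h5 : η / 4 * (4 / η * expectedError (spikedLaw η u) Q B) =
        expectedError (spikedLaw η u) Q B := by field_simp
    linarith
  calc _ = η / 200 := by rw [hη]; ring
    _ ≤ _ := h4

theorem mainTheorem1 (C : ℝ) (hC : 0 < C) :
    ∃ c κ : ℝ, 0 < c ∧ 0 < κ ∧
      ∀ (n d : ℕ), 2 ≤ n → 1 ≤ d →
      ∀ ε δ : ℝ, 0 < ε → ε ≤ C → 0 ≤ δ → δ ≤ κ / (n * Real.log n) →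
      ∀ (Z : Type*) [MeasurableSpace Z]
        (Q : Fin n → Kernel (Fin d) Z) [∀ i, IsMarkovKernel (Q i)],
        (∀ i, IsLDP ε δ (Q i)) →
      ∀ (B : Kernel (Fin n → Z) (Fin d → Set.Icc (0 : ℝ) 1)) [IsMarkovKernel B],
        ∃ P : Measure (Fin d), IsProbabilityMeasure P ∧
          c * min (1 / ε * Real.sqrt (Real.log d / n)) 1 ≤ expectedError P Q B := by
  -- `n m ≥ H` is exactly `n η ≥ 40`. It holds for `n ≥ N`: if `m = 1` because `n ≥ H`, and
  -- otherwise because `n m = √(n log d) / ε ≥ √n / (2C) ≥ H`.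
  set H := 200 * Real.exp (C / 2) with hH
  obtain ⟨N, hN⟩ := exists_nat_ge (max H ((2 * C * H) ^ 2))
  -- `L` dominates the base of the two-point bound, using `e^{-ε} ≤ 1` and `δ ≤ 1`; for `n < N` that
  -- bound is then at least `1 / (16 L^N)`.
  set L := 2 * (Real.exp C + 1) with hL
  have hL1 : 1 ≤ L := by linarith [Real.exp_pos C]
  refine ⟨min (Real.exp (-C / 2) / 1000) (1 / (16 * L ^ N)), 1 / 100, by positivity, by norm_num,
    fun n d hn hd ε δ hε hεC hδ hδκ Z _ Q _ hQ B _ => ?_⟩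
  have hn0 : n ≠ 0 := by omega
  have hnpos : (0 : ℝ) < n := by positivity
  have : NeZero d := ⟨by omega⟩
  have hnδ : n * δ ≤ 1 / 50 := by
    have hlog : (1 / 2 : ℝ) ≤ Real.log n :=
      (by linarith [Real.log_two_gt_d9] : (1 / 2 : ℝ) ≤ Real.log 2).trans
        (Real.log_le_log (by norm_num) (by exact_mod_cast hn))
    rw [le_div_iff₀ (by positivity)] at hδκ
    nlinarith [mul_nonneg hδ hnpos.le]
  set m := min (1 / ε * Real.sqrt (Real.log d / n)) 1 with hm
  have hm1 : m ≤ 1 := min_le_right _ _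
  rcases Nat.lt_or_ge d 2 with hd2 | hd2
  · obtain rfl : d = 1 := by omega
    refine ⟨Measure.dirac 0, inferInstance, ?_⟩
    have : m = 0 := by simp [hm]
    rw [this, mul_zero]
    exact expectedError_nonneg _ _ _
  have hlogd : (1 / 4 : ℝ) ≤ Real.log d :=
    (by linarith [Real.log_two_gt_d9] : (1 / 4 : ℝ) ≤ Real.log 2).trans
      (Real.log_le_log (by norm_num) (by exact_mod_cast hd2))
  have hq0 : 0 < Real.log d / n := by positivity
  have hm0 : 0 < m := lt_min (by positivity) one_pos
  rcases Nat.lt_or_ge n N with hnN | hnN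
  · refine ⟨spikedLaw (1 / 2) ⟨1, hd2⟩,
      isProbabilityMeasure_spikedLaw (by norm_num) (by norm_num) _, ?_⟩
    refine le_trans ?_ (expectedError_spikedLaw_half_ge hn0 hδ (by linarith)
      (Fin.ne_of_val_ne (by simp)) Q hQ B)
    have hδ1 : δ ≤ 1 := by
      have : (1 : ℝ) ≤ n := by exact_mod_cast (by omega : 1 ≤ n)
      nlinarith
    have hbase0 : 0 < Real.exp ε + Real.exp (-ε) - 1 + δ := by
      linarith [Real.add_one_le_exp ε, Real.add_one_le_exp (-ε)]
    have hbase : 2 * (Real.exp ε + Real.exp (-ε) - 1 + δ) ≤ L := by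
      have h1 : Real.exp (-ε) ≤ 1 := Real.exp_le_one_iff.2 (by linarith)
      have h2 : Real.exp ε ≤ Real.exp C := Real.exp_le_exp.2 hεC
      linarith
    calc _ ≤ 1 / (16 * L ^ N) * 1 := by
          gcongr
          exact min_le_right _ _
      _ ≤ _ := by
          rw [mul_one]
          gcongr
          exact (pow_le_pow_left₀ (by positivity) hbase n).trans (pow_le_pow_right₀ hL1 hnN.le)
  · have hnR : max H ((2 * C * H) ^ 2) ≤ n := hN.trans (by exact_mod_cast hnN)
    have hnH : H ≤ n := (le_max_left _ _).trans hnR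
    have hnC : 2 * C * H ≤ Real.sqrt n :=
      Real.le_sqrt_of_sq_le ((le_max_right _ _).trans hnR)
    have hle : m ≤ 1 / ε * Real.sqrt (Real.log d / n) := min_le_left _ _
    have hmsq : n * (ε * m) ^ 2 ≤ Real.log d := by
      have h1 : ε * m ≤ Real.sqrt (Real.log d / n) := by
        rw [one_div, inv_mul_eq_div, le_div_iff₀ hε] at hle
        linarith
      have h2 := pow_le_pow_left₀ (by positivity) h1 2
      rw [Real.sq_sqrt hq0.le, le_div_iff₀ hnpos] at h2
      linarith
    have hHm : H ≤ n * m := by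
      rcases min_choice (1 / ε * Real.sqrt (Real.log d / n)) 1 with h | h
      · rw [hm, h]
        have hs : 1 / 2 ≤ Real.sqrt (Real.log d) := Real.le_sqrt_of_sq_le (by linarith)
        have hsn : (n : ℝ) / Real.sqrt n = Real.sqrt n := Real.div_sqrt
        rw [Real.sqrt_div' _ hnpos.le]
        calc H = 1 / C * (2 * C * H) * (1 / 2) := by field_simp
          _ ≤ 1 / ε * Real.sqrt n * Real.sqrt (Real.log d) := by gcongr
          _ = 1 / ε * (n / Real.sqrt n) * Real.sqrt (Real.log d) := by rw [hsn]
          _ = _ := by ring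
      · rw [hm, h, mul_one]
        exact hnH
    have hnm : 40 ≤ n * (Real.exp (-C / 2) / 5 * m) := by
      have h1 : Real.exp (-C / 2) * Real.exp (C / 2) = 1 := by
        rw [← Real.exp_add]; simp [neg_div]
      have h2 := mul_le_mul_of_nonneg_left hHm (Real.exp_pos (-C / 2)).le
      rw [hH] at h2
      linarith
    obtain ⟨P, hP, hPE⟩ := exists_expectedError_ge_of_large hn0 hd2 hε hεC hδ hnδ hm0 hm1 hmsq hnm
      Q hQ B
    refine ⟨P, hP, le_trans ?_ hPE⟩
    gcongr
    exact min_le_left _ _
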